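/- Let $A$ be a finite-dimensional real alternative algebra with unity (not necessarily associative), with a fixed real-linear antiinvolution $x\mapsto x^c$ ($(x^c)^c=x$, $(xy)^c=y^cx^c$, $x^c=x$ for $x\in\mathbb R\subseteq A$). Put $t(x)=x+x^c$, $n(x)=xx^c$, \[N_A=\{0\}\cup\{x\in A : n(x)=n(x^c)\in\mathbb R\setminus\{0\}\},\qquad Q_A=\mathbb R\cup\{x\in A : t(x),n(x)\in\mathbb R,\ 4n(x)>t(x)^2\},\] and $\mathbb S_A=\{J\in Q_A : J^2=-1\}$; assume $Q_A\neq\mathbb R$. For $x=\alpha+\beta J\in Q_A$ ($\alpha,\beta\in\mathbb R$, $J\in\mathbb S_A$) let $\mathbb S_x=\{\alpha+\beta I : I\in\mathbb S_A\}$. A stem function is a map $F=F_1+iF_2:\mathbb C\to A\otimes_{\mathbb R}\mathbb C$ with $F_1,F_2$ $A$-valued and $F(\bar z)=\overline{F(z)}$. It induces the slice function $\mathcal I(F):Q_A\to A$, $\mathcal I(F)(\alpha+\beta J)=F_1(z)+JF_2(z)$, $z=\alpha+i\beta$; this is slice regular if $F$ is holomorphic. The product of slice functions is $\mathcal I(F)\cdot\mathcal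 I(G)=\mathcal I(FG)$, the normal function is $N(\mathcal I(F))=\mathcal I(FF^c)$ with $F^c=F_1^c+iF_2^c$, and $\mathcal I(F)$ is admissible if the real span of $F_1(z),F_2(z)$ is contained in $N_A$ for all $z\in\mathbb C$. For a function $f$ on $Q_A$ let $V(f)=\{x\in Q_A : f(x)=0\}$. For $y\in Q_A$ let $\Delta_y(x)=N(x-y)=x^2-x\,t(y)+n(y)$. A zero $y$ of $f$ has multiplicity $m_f(y)=s$ if $\Delta_y^s\mid N(f)$ and $\Delta_y^{s+1}\nmid N(f)$, where $g\mid h$ means $h=g\cdot k$ for some slice regular $k$ on $Q_A$. **Theorem (Fundamental Theorem of Algebra with multiplicities).** Let $p(x)=\sum_{j=0}^m x^ja_j$ be a polynomial with coefficients in $A$ of degree $m>0$ (so $a_m\ne0$), regarded as the slice function induced by $P(z)=\sum_{j=0}^m z^ja_j$. 1. If the real span $\langle a_0,\dots,a_m\rangle$ is contained in $N_A$, then $p$ is admissible and $n(a_m)\neq0$. 2. If $p$ is admissible, there are finitely many distinct spheres $\mathbb S_{x_1},\dots,\mathbb S_{x_t}$ ($x_k\in Q_A$) such that \[V(p)\subseteq\bigcup_{k=1}^t\mathbb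 S_{x_k}=V(N(p)),\qquad V(p)\cap\mathbb S_{x_k}\neq\emptyset\ \text{ for every }k.\] If moreover $n(a_m)\neq 0$ (equivalently, $N(p)$ has degree $2m$), then $V(p)\neq\emptyset$ and, for any choice of zeros $y_1\in\mathbb S_{x_1},\dots,y_t\in\mathbb S_{x_t}$ of $p$, the multiplicities $m_p(y_k)$ exist and \[\sum_{k=1}^t m_p(y_k)=m.\] -/

import Mathlib

open scoped ComplexConjugate

namespace SliceAlgebra

/-- A (not necessarily associative) unital ring is alternative if its associator
`(x * y) * z - x * (y * z)` is an alternating function of its three arguments. -/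
class IsAlternative (A : Type*) [NonAssocRing A] : Prop where
  assoc_left : ∀ x y : A, associator x x y = 0
  assoc_right : ∀ x y : A, associator x y y = 0
  assoc_flex : ∀ x y : A, associator x y x = 0

/-! ### The quadratic cone and the normal cone

`A` is a real algebra; its antiinvolution `x ↦ x^c` is `star`. A real number `r` is identified
with the element `r • 1` of `A`. -/

section Cones

variable (A : Type*) [NonAssocRing A] [Module ℝ A] [StarRing A]

/-- The copy of the real numbers in `A`. -/
def realLine : Set A := Set.range fun r : ℝ => r • (1 : A)

variable {A}

/-- The trace `t(x) = x + x^c`. -/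
def trace (x : A) : A := x + star x

/-- The squared norm `n(x) = x x^c`, an element of `A`. -/
def sqNorm (x : A) : A := x * star x

variable (A)

/-- The normal cone: `0`, and all `x` for which `n(x) = n(x^c)` is a nonzero real number. -/
def normalCone : Set A :=
  {0} ∪ {x | ∃ r : ℝ, r ≠ 0 ∧ sqNorm x = r • (1 : A) ∧ sqNorm (star x) = r • (1 : A)}

/-- The quadratic cone: the real numbers, and all `x` for which `t(x)` and `n(x)` are real
and `4 n(x) > t(x) ^ 2`. -/
def quadraticCone : Set A :=
  realLine A ∪
    {x | ∃ t n : ℝ, trace x = t • (1 : A) ∧ sqNorm x = n • (1 : A) ∧ 4 * n > t ^ 2}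

/-- The square roots of `-1` in the quadratic cone. -/
def imagUnits : Set A := {J | J ∈ quadraticCone A ∧ J * J = -1}

variable {A}

/-- The sphere of `x = α + β J`: all `α + β I`, where `I` is a square root of `-1`. -/
def sphere (x : A) : Set A :=
  {y | ∃ (α β : ℝ), ∃ J ∈ imagUnits A, ∃ I ∈ imagUnits A,
    x = α • (1 : A) + β • J ∧ y = α • (1 : A) + β • I}

/-- The zero set, in the quadratic cone, of a function. -/
def zeroSet (f : A → A) : Set A := {x | x ∈ quadraticCone A ∧ f x = 0}

end Cones

/-! ### Stem functions and slice functions -/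

/-- A stem function `F = F₁ + i F₂` on `ℂ` with values in the complexification
`A ⊗ ℂ = A + i A`: the pair of its components, which satisfies `F(conj z) = conj (F z)`. -/
@[ext]
structure StemFunction (A : Type*) [NonAssocRing A] where
  fst : ℂ → A
  snd : ℂ → A
  fst_conj : ∀ z, fst (conj z) = fst z
  snd_conj : ∀ z, snd (conj z) = -snd z

namespace StemFunction

variable {A : Type*} [NonAssocRing A]

/-- The constant stem function `1`. -/
def one : StemFunction A where
  fst _ := 1
  snd _ := 0
  fst_conj _ := rfl
  snd_conj _ := by simp

/-- The pointwise product in the complexification: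
`(x + i y) (x' + i y') = x x' - y y' + i (x y' + y x')`. -/
def mul (F G : StemFunction A) : StemFunction A where
  fst z := F.fst z * G.fst z - F.snd z * G.snd z
  snd z := F.fst z * G.snd z + F.snd z * G.fst z
  fst_conj z := by simp [F.fst_conj, F.snd_conj, G.fst_conj, G.snd_conj]
  snd_conj z := by
    simp only [F.fst_conj, F.snd_conj, G.fst_conj, G.snd_conj, mul_neg, neg_mul]; abel

/-- Powers of a stem function. -/
def npow (F : StemFunction A) : ℕ → StemFunction A
  | 0 => one
  | s + 1 => F.mul (npow F s)

/-- `F^c = F₁^c + i F₂^c`. -/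
def cconj [StarRing A] (F : StemFunction A) : StemFunction A where
  fst z := star (F.fst z)
  snd z := star (F.snd z)
  fst_conj z := by rw [F.fst_conj]
  snd_conj z := by rw [F.snd_conj, star_neg]

/-- `CN(F) = F F^c`, the stem function of the normal function. -/
def normal [StarRing A] (F : StemFunction A) : StemFunction A := F.mul F.cconj

variable [Module ℝ A]

/-- Holomorphy with respect to the complex structure of `A + i A`. It is read off coordinates:
for every real-linear functional `φ` on `A` the complex function `φ(F₁) + i φ(F₂)` is entire. -/
def IsHolomorphic (F : StemFunction A) : Prop :=
  ∀ φ : A →ₗ[ℝ] ℝ, Differentiable ℂ fun z : ℂ => (⟨φ (F.fst z), φ (F.snd z)⟩ : ℂ)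

variable [StarRing A]

/-- A stem function is admissible if the real span of `F₁(z)` and `F₂(z)` lies in the normal
cone for every `z`. -/
def IsAdmissible (F : StemFunction A) : Prop :=
  ∀ z : ℂ, (Submodule.span ℝ {F.fst z, F.snd z} : Set A) ⊆ normalCone A

open Classical in
/-- The slice function `f = I(F)` on the quadratic cone: `f(α + β J) = F₁(z) + J F₂(z)`, where
`z = α + i β` and `J` is a square root of `-1`. It does not depend on the chosen representation
of the point, see `slice_apply`; the value outside the quadratic cone is irrelevant. -/
noncomputable def slice (F : StemFunction A) (x : A) : A :=
  if h : ∃ q : ℝ × ℝ × A, q.2.2 ∈ imagUnits A ∧ x = q.1 • (1 : A) + q.2.1 • q.2.2 then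
    F.fst ⟨h.choose.1, h.choose.2.1⟩ + h.choose.2.2 * F.snd ⟨h.choose.1, h.choose.2.1⟩
  else 0

end StemFunction

section WellDefined

variable {A : Type*} [NonAssocRing A] [Module ℝ A] [IsScalarTower ℝ A A] [SMulCommClass ℝ A A]
  [StarRing A] [StarModule ℝ A]

set_option linter.unusedSectionVars false

theorem star_real (r : ℝ) : star (r • (1 : A)) = r • (1 : A) := by
  rw [star_smul]; simp

theorem real_ne_imag [Nontrivial A] {J : A} (hJ : J * J = -1) (r : ℝ) : J ≠ r • (1 : A) := by
  rintro rfl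
  have h : (r * r + 1) • (1 : A) = 0 := by
    rw [add_smul, one_smul, mul_smul]
    rw [smul_mul_assoc, one_mul] at hJ
    rw [hJ]; simp
  rcases smul_eq_zero.1 h with h | h
  · nlinarith [mul_self_nonneg r]
  · exact one_ne_zero h

theorem star_of_mem_imagUnits [Nontrivial A] {J : A} (hJ : J ∈ imagUnits A) : star J = -J := by
  obtain ⟨h, h2⟩ := hJ
  rcases h with ⟨r, hr⟩ | ⟨t, n, ht, hn, -⟩
  · exact absurd hr.symm (real_ne_imag h2 r)
  · have hs : star J = t • (1 : A) - J := by rw [← ht, trace]; abel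
    rw [sqNorm, hs, mul_sub, h2, mul_smul_comm, mul_one] at hn
    by_cases h0 : t = 0
    · rw [hs, h0]; simp
    · exfalso
      apply real_ne_imag h2 (t⁻¹ * (n - 1))
      rw [mul_smul, sub_smul, ← hn, one_smul]
      simp [smul_smul, h0]

/-- The value of a slice function does not depend on the representation of the point. -/
theorem StemFunction.slice_apply [Nontrivial A] (F : StemFunction A) (α β : ℝ) {J : A}
    (hJ : J ∈ imagUnits A) :
    F.slice (α • (1 : A) + β • J) = F.fst ⟨α, β⟩ + J * F.snd ⟨α, β⟩ := by
  have h : ∃ q : ℝ × ℝ × A, q.2.2 ∈ imagUnits A ∧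
      α • (1 : A) + β • J = q.1 • (1 : A) + q.2.1 • q.2.2 := ⟨(α, β, J), hJ, rfl⟩
  rw [StemFunction.slice, dif_pos h]
  generalize hq : h.choose = q
  obtain ⟨hI, he⟩ := h.choose_spec
  rw [hq] at hI he
  obtain ⟨a, b, I⟩ := q
  simp only at hI he ⊢
  have hs := congrArg star he
  rw [star_add, star_add, star_real, star_real, star_smul, star_smul,
    star_of_mem_imagUnits hJ, star_of_mem_imagUnits hI] at hs
  simp only [star_trivial, smul_neg] at hs
  have h2 : ((2 : ℝ) * (α - a)) • (1 : A) = 0 := by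
    have : (2 : ℝ) • (α • (1 : A)) = (2 : ℝ) • (a • (1 : A)) := by
      rw [two_smul, two_smul]
      have : (α • (1 : A) + β • J) + (α • (1 : A) + -(β • J)) =
        (a • (1 : A) + b • I) + (a • (1 : A) + -(b • I)) := by rw [he, hs]
      calc _ = α • (1 : A) + β • J + (α • (1 : A) + -(β • J)) := by abel
        _ = _ := this
        _ = _ := by abel
    rw [mul_smul, sub_smul, smul_sub, this, sub_self]
  have hα : α = a := by
    rcases smul_eq_zero.1 h2 with h | h
    · linarith
    · exact absurd h one_ne_zero
  subst hα
  have hb : β • J = b • I := add_left_cancel he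
  have hsq : (β * β - b * b) • (1 : A) = 0 := by
    have h3 := congrArg₂ (· * ·) hb hb
    simp only [smul_mul_assoc, mul_smul_comm, hJ.2, hI.2, smul_neg, neg_inj, smul_smul] at h3
    rw [sub_smul, h3, sub_self]
  have hββ : β = b ∨ β = -b := by
    rcases smul_eq_zero.1 hsq with h | h
    · exact mul_self_eq_mul_self_iff.1 (by linarith)
    · exact absurd h one_ne_zero
  have hconj : ∀ b : ℝ, (⟨α, -b⟩ : ℂ) = conj (⟨α, b⟩ : ℂ) := fun b => rfl
  have hz : F.snd ⟨α, 0⟩ = 0 := by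
    have h5 := F.snd_conj ⟨α, 0⟩
    rw [← hconj, neg_zero] at h5
    have h6 : (2 : ℝ) • F.snd ⟨α, 0⟩ = 0 := by
      rw [two_smul]; nth_rewrite 1 [h5]; simp
    exact (smul_eq_zero.1 h6).resolve_left two_ne_zero
  by_cases hb0 : b = 0
  · subst hb0
    have : β = 0 := by simpa using hββ
    subst this
    simp [hz]
  rcases hββ with rfl | rfl
  · rw [smul_right_injective A hb0 hb]
  · rw [hconj, F.fst_conj, F.snd_conj]
    have : -J = I := smul_right_injective A hb0 (by simpa using hb)
    rw [← this]; simp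

end WellDefined

/-! ### Divisibility and multiplicity -/

section Multiplicity

variable {A : Type*} [NonAssocRing A] [Module ℝ A] [StarRing A]

/-- The stem function `z - y` of the function `x - y`. -/
def linStem (y : A) : StemFunction A where
  fst z := z.re • (1 : A) - y
  snd z := z.im • (1 : A)
  fst_conj z := by simp
  snd_conj z := by simp

/-- The stem function of the characteristic polynomial `Δ_y = N(x - y)` of `y`. -/
def charStem (y : A) : StemFunction A := (linStem y).normal

/-- `F` divides `G` among slice regular functions on the quadratic cone: there is a slice regular
function, with (holomorphic) stem function `H`, such that `I(G)` is the slice product of `I(F)`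
and `I(H)`. -/
def SliceDvd (F G : StemFunction A) : Prop :=
  ∃ H : StemFunction A, H.IsHolomorphic ∧
    Set.EqOn G.slice (F.mul H).slice (quadraticCone A)

/-- The zero `y` of `I(F)` has multiplicity `s`: `Δ_y ^ s` divides `N(I(F))` and
`Δ_y ^ (s + 1)` does not. -/
def HasMultiplicity (F : StemFunction A) (y : A) (s : ℕ) : Prop :=
  SliceDvd ((charStem y).npow s) F.normal ∧ ¬ SliceDvd ((charStem y).npow (s + 1)) F.normal

end Multiplicity

/-! ### Polynomials with coefficients on the right -/

section Polynomials

set_option linter.unusedSectionVars false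

variable {A : Type*} [NonAssocRing A]

/-- The power `x ^ j`. -/
def power (x : A) : ℕ → A
  | 0 => 1
  | j + 1 => x * power x j

/-- The polynomial function `p(x) = ∑ x ^ j a_j`. -/
def polyEval {m : ℕ} (a : Fin (m + 1) → A) (x : A) : A := ∑ j : Fin (m + 1), power x j * a j

variable [Module ℝ A]

/-- The stem function `P(z) = ∑ z ^ j a_j = ∑ Re(z ^ j) a_j + i ∑ Im(z ^ j) a_j`
of the polynomial `p(x) = ∑ x ^ j a_j`, see `slice_polyStem`. -/
def polyStem {m : ℕ} (a : Fin (m + 1) → A) : StemFunction A where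
  fst z := ∑ j : Fin (m + 1), (z ^ (j : ℕ)).re • a j
  snd z := ∑ j : Fin (m + 1), (z ^ (j : ℕ)).im • a j
  fst_conj z := by simp [← map_pow]
  snd_conj z := by simp [← map_pow]

variable [IsScalarTower ℝ A A] [SMulCommClass ℝ A A] [StarRing A] [StarModule ℝ A]

theorem power_apply (α β : ℝ) {J : A} (hJ : J ∈ imagUnits A) (j : ℕ) :
    power (α • (1 : A) + β • J) j =
      ((⟨α, β⟩ : ℂ) ^ j).re • (1 : A) + ((⟨α, β⟩ : ℂ) ^ j).im • J := by
  induction j with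
  | zero => simp [power]
  | succ j ih =>
    rw [power, ih, pow_succ']
    simp only [add_mul, mul_add, smul_mul_assoc, mul_smul_comm, one_mul, mul_one, hJ.2,
      Complex.mul_re, Complex.mul_im]
    module

/-- On the quadratic cone a polynomial is the slice function of its stem function. -/
theorem slice_polyStem [Nontrivial A] {m : ℕ} (a : Fin (m + 1) → A) (α β : ℝ) {J : A}
    (hJ : J ∈ imagUnits A) :
    polyEval a (α • (1 : A) + β • J) = (polyStem a).slice (α • (1 : A) + β • J) := by
  rw [StemFunction.slice_apply _ _ _ hJ]
  simp [polyEval, polyStem, power_apply α β hJ, add_mul, Finset.sum_add_distrib, Finset.mul_sum,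
    smul_mul_assoc, mul_smul_comm]

end Polynomials

end SliceAlgebra

open SliceAlgebra

/-! Admissibility forces n(F₁), n(F₂) and the polarization F₁F₂^c + F₂F₁^c to be real, so N(p) is a
polynomial with real coefficients (`normal_eq_realStem`), and the theorem reduces to factoring it
over ℝ.

Two facts carry the argument. On each real span of F₁(z), F₂(z) the form n is anisotropic, hence
definite (`eq_zero_of_sqNorm_add_sqNorm`). Therefore g = n(F₁) + n(F₂), which restricts to N(p) on
ℝ, vanishes on ℂ only at finitely many points. Their complement is connected, so N(p) has constant
sign on ℝ (`normalPoly_sign`). Real roots then have even multiplicity, and N(p) is a constant times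
a product of quadratics with conjugate roots, m of them when n(a_m) ≠ 0.

Secondly, zeros of p and of N(p) lie on the same spheres: if N(p) vanishes at z and F₂(z) ≠ 0, then
J = -F₁F₂⁻¹ is an imaginary unit solving F₁ + JF₂ = 0. Here alternativity replaces associativity,
through the left Moufang identity.

Since Δ_y is the real quadratic attached to the sphere of y, m_p(y) is the number of times that
quadratic occurs in N(p), and these numbers add up to m. -/

namespace SliceAlgebra

set_option linter.unusedSectionVars false

/-! ### Associator identities in alternative rings -/

section Alternative

variable {A : Type*} [NonAssocRing A]

/-- Valid in every nonassociative ring: all terms expand into the five bracketings of four factors.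
Specializing two arguments to the same x gives the next identities. -/
theorem associator_teichmuller (a b c d : A) :
    associator (a * b) c d - associator a (b * c) d + associator a b (c * d) =
      a * associator b c d + associator a b c * d := by
  simp only [associator_apply, mul_sub, sub_mul]
  abel

variable [IsAlternative A]

theorem associator_swap_left (x y z : A) : associator x y z = -associator y x z := by
  have h := IsAlternative.assoc_left (x + y) z
  have hx := IsAlternative.assoc_left x z
  have hy := IsAlternative.assoc_left y z
  simp only [associator_apply, add_mul, mul_add] at *
  linear_combination (norm := abel) h - hx - hy

theorem associator_swap_right (x y z : A) : associator x y z = -associator x z y := by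
  have h := IsAlternative.assoc_right x (y + z)
  have hx := IsAlternative.assoc_right x y
  have hy := IsAlternative.assoc_right x z
  simp only [associator_apply, add_mul, mul_add] at *
  linear_combination (norm := abel) h - hx - hy

theorem associator_cycle (x y z : A) : associator x y z = associator y z x := by
  rw [associator_swap_left, associator_swap_right, neg_neg]

/-- The Teichmüller identities for (x, x, z, y) and (y, x, x, z) add up to this one: the terms with
x² and with x * z cancel by skew-symmetry. -/
theorem associator_mul_right_self (x y z : A) :
    associator x (y * x) z = x * associator x y z := by
  have h1 := associator_teichmuller x x y z
  have h1' := associator_teichmuller x x z y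
  have h2 := associator_teichmuller y x x z
  rw [IsAlternative.assoc_left, IsAlternative.assoc_left, zero_mul, add_zero, add_zero] at h1 h1'
  rw [IsAlternative.assoc_left, IsAlternative.assoc_right, zero_mul, mul_zero,
    associator_swap_left (y * x), associator_swap_left y (x * x), associator_cycle y x,
    add_zero] at h2
  rw [associator_swap_right (x * x), associator_swap_right x z, mul_neg] at h1'
  linear_combination (norm := abel) -h1' - h2

theorem associator_mul_left_self (x y z : A) :
    associator x (x * y) z = associator x y z * x := by
  have h1 := associator_teichmuller x x y z
  have h3 := associator_teichmuller y z x x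
  rw [IsAlternative.assoc_left, IsAlternative.assoc_left, zero_mul, add_zero, add_zero] at h1
  rw [IsAlternative.assoc_right, IsAlternative.assoc_right, mul_zero, zero_add, zero_sub,
    ← associator_cycle x y (z * x), associator_swap_right x y, associator_mul_right_self,
    ← associator_cycle x y z, ← associator_cycle (x * x) y z, associator_swap_right x z,
    mul_neg, neg_neg] at h3
  linear_combination (norm := abel) h3 - h1

/-- The left Moufang identity. -/
theorem mul_mul_mul_self (x y z : A) : x * (y * (x * z)) = x * y * x * z := by
  have h1 : associator x y (x * z) = associator x y z * x := by
    rw [associator_swap_right, associator_mul_left_self, associator_swap_right x z, neg_mul,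
      neg_neg]
  have h2 : associator (x * y) x z = -(associator x y z * x) := by
    rw [associator_swap_left, associator_mul_left_self]
  have h3 : associator x y (x * z) + associator (x * y) x z = 0 := by rw [h1, h2, add_neg_cancel]
  simp only [associator_apply] at h3
  linear_combination (norm := abel) -h3

/-- Since x(ww) = w, the Moufang identity gives x((ww)(xz)) = (wx)z = z, so left multiplication by x
is injective. The claim follows from x(w(xz)) = (xwx)z = xz. -/
theorem mul_mul_cancel_of_inverse {x w : A} (h : x * w = 1) (h' : w * x = 1) (z : A) :
    w * (x * z) = z := by
  have h1 : x * (w * w) = w := by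
    have := IsAlternative.assoc_right x w
    rw [associator_apply, h, one_mul, sub_eq_zero] at this
    exact this.symm
  have inj : Function.Injective (x * · : A → A) := by
    refine Function.LeftInverse.injective (g := fun z => x * (w * w * z)) fun z => ?_
    simp only
    rw [mul_mul_mul_self, h1, h', one_mul]
  apply inj
  simp only
  rw [mul_mul_mul_self, h, one_mul]

end Alternative

/-! ### Cancellation in the normal cone -/

section NormalCone

variable {A : Type*} [NonAssocRing A] [IsAlternative A] [Module ℝ A]
    [IsScalarTower ℝ A A] [SMulCommClass ℝ A A] [StarRing A] [StarModule ℝ A]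

/-- The elements of the normal cone have a real squared norm, which is nonzero unless they vanish,
and they associate with their conjugates. -/
theorem exists_sqNorm_of_mem_normalCone {y : A} (hy : y ∈ normalCone A) :
    ∃ r : ℝ, y * star y = r • (1 : A) ∧ (r = 0 → y = 0) ∧ (∀ z, z * y * star y = r • z) ∧
      ∀ z, z * star y * y = r • z := by
  rcases hy with rfl | ⟨r, hr, h1, h2⟩
  · exact ⟨0, by simp⟩
  · rw [sqNorm] at h1 h2
    rw [star_star] at h2
    have key : ∀ u v : A, u * v = r • (1 : A) → v * u = r • (1 : A) → ∀ z, v * (u * z) = r • z := by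
      intro u v huv hvu z
      have := mul_mul_cancel_of_inverse (x := r⁻¹ • u) (w := v)
        (by rw [smul_mul_assoc, huv, inv_smul_smul₀ hr])
        (by rw [mul_smul_comm, hvu, inv_smul_smul₀ hr]) z
      rw [smul_mul_assoc, mul_smul_comm] at this
      rw [← this, smul_inv_smul₀ hr, this]
    refine ⟨r, h1, fun h => absurd h hr, fun z => ?_, fun z => ?_⟩
    -- The antiinvolution turns left cancellation into right cancellation.
    · have := congrArg star (key _ _ h2 h1 (star z))
      simpa [star_smul] using this
    · have := congrArg star (key _ _ h1 h2 (star z))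
      simpa [star_smul] using this

end NormalCone

/-! ### Representation of points of the quadratic cone -/

section Cone

variable {A : Type*} [NonAssocRing A] [Module ℝ A]
    [IsScalarTower ℝ A A] [SMulCommClass ℝ A A] [StarRing A] [StarModule ℝ A]

theorem mem_imagUnits_of_star {J : A} (h : star J = -J) (h2 : J * J = -1) : J ∈ imagUnits A := by
  refine ⟨Or.inr ⟨0, 1, by simp [trace, h], by simp [sqNorm, h, h2], by norm_num⟩, h2⟩

theorem neg_mem_imagUnits [Nontrivial A] {J : A} (hJ : J ∈ imagUnits A) : -J ∈ imagUnits A :=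
  mem_imagUnits_of_star (by rw [star_neg, star_of_mem_imagUnits hJ]) (by simpa using hJ.2)

theorem add_smul_mem_quadraticCone [Nontrivial A] (α β : ℝ) {J : A} (hJ : J ∈ imagUnits A) :
    α • (1 : A) + β • J ∈ quadraticCone A := by
  by_cases hβ : β = 0
  · exact Or.inl ⟨α, by simp [hβ]⟩
  · refine Or.inr ⟨2 * α, α ^ 2 + β ^ 2, ?_, ?_, by nlinarith [sq_pos_of_ne_zero hβ]⟩
    · rw [trace, star_add, star_real, star_smul, star_of_mem_imagUnits hJ, star_trivial]
      module
    · rw [sqNorm, star_add, star_real, star_smul, star_of_mem_imagUnits hJ, star_trivial]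
      simp only [add_mul, mul_add, smul_mul_assoc, mul_smul_comm, one_mul, mul_one, mul_neg, hJ.2]
      module

theorem exists_imagUnit_of_notMem_realLine {x : A} (hx : x ∈ quadraticCone A)
    (hr : x ∉ realLine A) : ∃ α β : ℝ, ∃ J ∈ imagUnits A, x = α • (1 : A) + β • J := by
  rcases hx with hx | ⟨t, n, ht, hn, h⟩
  · exact absurd hx hr
  have hs : star x = t • (1 : A) - x := by rw [← ht, trace]; abel
  have hxx : x * x = t • x - n • (1 : A) := by
    rw [← hn, sqNorm, hs, mul_sub, mul_smul_comm, mul_one]; abel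
  -- Completing the square in x² - tx + n = 0: (x - t/2)² = -β².
  set β := √(n - t ^ 2 / 4)
  have hβ : β ^ 2 = n - t ^ 2 / 4 := Real.sq_sqrt (by linarith)
  have hβ0 : β ≠ 0 := by
    intro h0
    rw [h0] at hβ
    nlinarith
  refine ⟨t / 2, β, β⁻¹ • (x - (t / 2) • (1 : A)), mem_imagUnits_of_star ?_ ?_, ?_⟩
  · rw [star_smul, star_sub, star_real, star_trivial, hs]
    module
  · simp only [sub_mul, mul_sub, smul_mul_assoc, mul_smul_comm, one_mul, mul_one, hxx]
    have : β⁻¹ * β⁻¹ * (n - t ^ 2 / 4) = 1 := by rw [← hβ]; field_simp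
    calc _ = (-(β⁻¹ * β⁻¹ * (n - t ^ 2 / 4))) • (1 : A) := by module
      _ = -1 := by rw [this]; simp
  · rw [smul_inv_smul₀ hβ0]; abel

theorem exists_imagUnit (hQ : quadraticCone A ≠ realLine A) : ∃ J, J ∈ imagUnits A := by
  by_contra! h
  refine hQ (Set.Subset.antisymm (fun x hx => ?_) Set.subset_union_left)
  by_contra hr
  obtain ⟨_, _, J, hJ, -⟩ := exists_imagUnit_of_notMem_realLine hx hr
  exact h J hJ

theorem exists_eq_add_smul (hQ : quadraticCone A ≠ realLine A) {x : A} (hx : x ∈ quadraticCone A) :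
    ∃ α β : ℝ, ∃ J ∈ imagUnits A, x = α • (1 : A) + β • J := by
  by_cases hr : x ∈ realLine A
  · obtain ⟨r, rfl⟩ := hr
    obtain ⟨J, hJ⟩ := exists_imagUnit hQ
    exact ⟨r, 0, J, hJ, by simp⟩
  · exact exists_imagUnit_of_notMem_realLine hx hr

/-- The slice functions induced by Re z and (Im z)² are well defined and read off α and β². The sign
of β is lost, because (β, J) and (-β, -J) give the same point. -/
theorem add_smul_inj [Nontrivial A] {α β α' β' : ℝ} {J J' : A} (hJ : J ∈ imagUnits A)
    (hJ' : J' ∈ imagUnits A) (h : α • (1 : A) + β • J = α' • (1 : A) + β' • J') :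
    α = α' ∧ β ^ 2 = β' ^ 2 := by
  have inj : Function.Injective fun r : ℝ => r • (1 : A) := smul_left_injective ℝ one_ne_zero
  let R : StemFunction A := ⟨fun z => z.re • 1, fun _ => 0, by simp, by simp⟩
  let S : StemFunction A := ⟨fun z => (z.im ^ 2) • 1, fun _ => 0, by simp, by simp⟩
  have hR := congrArg R.slice h
  have hS := congrArg S.slice h
  rw [StemFunction.slice_apply _ _ _ hJ, StemFunction.slice_apply _ _ _ hJ'] at hR hS
  exact ⟨inj (by simpa [R] using hR), inj (by simpa [S] using hS)⟩

end Cone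

/-! ### Real polynomials of constant sign and their quadratic factors -/

section RealPolynomials

open Polynomial

/-- The monic real quadratic polynomial with roots `ζ` and `conj ζ`. -/
noncomputable def conjPoly (ζ : ℂ) : ℝ[X] := X ^ 2 - C (2 * ζ.re) * X + C (‖ζ‖ ^ 2)

theorem monic_conjPoly (ζ : ℂ) : (conjPoly ζ).Monic := by
  unfold conjPoly; monicity!

theorem natDegree_conjPoly (ζ : ℂ) : (conjPoly ζ).natDegree = 2 := by
  unfold conjPoly; compute_degree!

theorem aeval_conjPoly (ζ z : ℂ) : aeval z (conjPoly ζ) = (z - ζ) * (z - conj ζ) := by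
  have h1 : (2 : ℝ) * (ζ.re : ℂ) = ζ + conj ζ := by rw [Complex.add_conj]; push_cast; rfl
  have h2 : (‖ζ‖ : ℂ) ^ 2 = ζ * conj ζ := (Complex.mul_conj' ζ).symm
  simp only [conjPoly, map_add, map_sub, map_mul, map_pow, aeval_X, aeval_C,
    Complex.coe_algebraMap]
  rw [h1, h2]
  ring

theorem eval_conjPoly (ζ : ℂ) (r : ℝ) : (conjPoly ζ).eval r = (r - ζ.re) ^ 2 + ζ.im ^ 2 := by
  have : ‖ζ‖ ^ 2 = ζ.re ^ 2 + ζ.im ^ 2 := by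
    rw [← Complex.normSq_eq_norm_sq, Complex.normSq_apply]; ring
  simp only [conjPoly, eval_add, eval_sub, eval_mul, eval_pow, eval_X, eval_C, this]
  ring

theorem eq_or_eq_conj_of_aeval_conjPoly {ζ z : ℂ} (h : aeval z (conjPoly ζ) = 0) :
    z = ζ ∨ z = conj ζ := by
  rw [aeval_conjPoly] at h
  exact (mul_eq_zero.1 h).imp sub_eq_zero.1 sub_eq_zero.1

/-- A root is a minimum of q, so the derivative vanishes there as well. -/
theorem sq_dvd_of_isRoot_of_nonneg {q : ℝ[X]} (h0 : q ≠ 0) (hq : ∀ r, 0 ≤ q.eval r) {α : ℝ}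
    (hα : q.IsRoot α) : (X - C α) ^ 2 ∣ q := by
  rw [← le_rootMultiplicity_iff h0]
  refine (one_lt_rootMultiplicity_iff_isRoot h0).2 ⟨hα, ?_⟩
  have : IsLocalMin (fun r => q.eval r) α :=
    Filter.Eventually.of_forall fun r => by
      change q.eval α ≤ q.eval r
      rw [hα.eq_zero]; exact hq r
  simpa using this.deriv_eq_zero

/-- A real polynomial that is nonnegative on the real line is a product of quadratic polynomials
with conjugate roots. -/
theorem exists_eq_prod_conjPoly (q : ℝ[X]) (h0 : q ≠ 0) (hq : ∀ r, 0 ≤ q.eval r) :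
    ∃ c : ℝ, c ≠ 0 ∧ ∃ M : Multiset ℂ, (∀ ζ ∈ M, 0 ≤ ζ.im) ∧
      q = C c * (M.map conjPoly).prod := by
  induction hn : q.natDegree using Nat.strong_induction_on generalizing q with
  | _ n ih =>
    subst hn
    by_cases hd : q.natDegree = 0
    · obtain ⟨c, rfl⟩ := natDegree_eq_zero.1 hd
      exact ⟨c, by rintro rfl; simp at h0, 0, by simp, by simp⟩
    obtain ⟨z, hz⟩ := IsAlgClosed.exists_aeval_eq_zero ℂ q
      fun h => hd (natDegree_eq_of_degree_eq_some h)
    have hdvd : ∃ ζ : ℂ, 0 ≤ ζ.im ∧ conjPoly ζ ∣ q := by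
      by_cases him : z.im = 0
      · refine ⟨z, him.ge, ?_⟩
        have hzr : z = (z.re : ℂ) := by apply Complex.ext <;> simp [him]
        have hroot : q.IsRoot z.re := by
          have h : ((q.eval z.re : ℝ) : ℂ) = aeval (z.re : ℂ) q :=
            (aeval_ofReal (K := ℂ) q z.re).symm
          rw [← hzr, hz] at h
          exact Complex.ofReal_eq_zero.1 h
        convert sq_dvd_of_isRoot_of_nonneg h0 hq hroot using 1
        refine Polynomial.funext fun r => ?_
        rw [eval_conjPoly, him]
        simp
      · rcases le_total 0 z.im with h | h
        · exact ⟨z, h, q.quadratic_dvd_of_aeval_eq_zero_im_ne_zero hz him⟩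
        · refine ⟨conj z, by simpa using h, q.quadratic_dvd_of_aeval_eq_zero_im_ne_zero ?_ ?_⟩
          · rw [aeval_conj, hz, map_zero]
          · simpa using him
    obtain ⟨ζ, hζ, q', rfl⟩ := hdvd
    have h0' : q' ≠ 0 := right_ne_zero_of_mul h0
    have hpos : ∀ r, r ≠ ζ.re → 0 ≤ q'.eval r := by
      intro r hr
      have h := hq r
      rw [eval_mul, eval_conjPoly] at h
      exact nonneg_of_mul_nonneg_right h
        (add_pos_of_pos_of_nonneg (sq_pos_of_ne_zero (sub_ne_zero.2 hr)) (sq_nonneg _))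
    -- Only at r = Re ζ can the removed factor vanish; there nonnegativity passes to the limit.
    have hq' : ∀ r, 0 ≤ q'.eval r := by
      intro r
      by_cases hr : r = ζ.re
      · refine ge_of_tendsto (x := nhdsWithin r {r}ᶜ) (f := fun s => q'.eval s)
          (q'.continuous.continuousAt.tendsto.mono_left nhdsWithin_le_nhds) ?_
        filter_upwards [self_mem_nhdsWithin] with s hs
        exact hpos s (by rw [← hr]; exact hs)
      · exact hpos r hr
    obtain ⟨c, hc, M, hM, rfl⟩ := ih q'.natDegree
      (by rw [natDegree_mul (monic_conjPoly ζ).ne_zero h0', natDegree_conjPoly]; omega) q' h0' hq' rfl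
    refine ⟨c, hc, ζ ::ₘ M, ?_, ?_⟩
    · simpa [hζ] using hM
    · rw [Multiset.map_cons, Multiset.prod_cons]; ring

theorem natDegree_prod_conjPoly {c : ℝ} (hc : c ≠ 0) (M : Multiset ℂ) :
    (C c * (M.map conjPoly).prod).natDegree = 2 * M.card := by
  rw [natDegree_C_mul hc, natDegree_multiset_prod_of_monic]
  · simp [natDegree_conjPoly, mul_comm]
  · simp only [Multiset.mem_map]
    rintro _ ⟨ζ, -, rfl⟩
    exact monic_conjPoly ζ

theorem aeval_prod_conjPoly_eq_zero {c : ℝ} (hc : c ≠ 0) {M : Multiset ℂ} {z : ℂ} :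
    aeval z (C c * (M.map conjPoly).prod) = 0 ↔ ∃ ζ ∈ M, z = ζ ∨ z = conj ζ := by
  rw [map_mul, aeval_C, mul_eq_zero, map_multiset_prod, Multiset.prod_eq_zero_iff]
  simp only [Multiset.map_map, Multiset.mem_map, Function.comp_apply, Complex.coe_algebraMap,
    Complex.ofReal_eq_zero, hc, false_or]
  refine exists_congr fun ζ => and_congr_right fun _ =>
    ⟨eq_or_eq_conj_of_aeval_conjPoly, fun h => ?_⟩
  rw [aeval_conjPoly, mul_eq_zero, sub_eq_zero, sub_eq_zero]
  exact h

/-- Restricting to the closed upper half-plane makes distinct members of M give quadratics without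
common roots: ζ = conj w with both imaginary parts nonnegative forces w = ζ. -/
theorem exists_eq_conjPoly_pow_count_mul {c : ℝ} (hc : c ≠ 0) {M : Multiset ℂ}
    (hM : ∀ ζ ∈ M, 0 ≤ ζ.im) {ζ : ℂ} (hζ : 0 ≤ ζ.im) :
    ∃ R : ℝ[X], C c * (M.map conjPoly).prod = conjPoly ζ ^ M.count ζ * R ∧ aeval ζ R ≠ 0 := by
  refine ⟨C c * ((M.filter (· ≠ ζ)).map conjPoly).prod, ?_, ?_⟩
  · conv_lhs => rw [← Multiset.filter_add_not (· = ζ) M, Multiset.filter_eq']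
    rw [Multiset.map_add, Multiset.prod_add, Multiset.map_replicate, Multiset.prod_replicate]
    ring
  · rw [Ne, aeval_prod_conjPoly_eq_zero hc]
    rintro ⟨w, hw, h⟩
    rw [Multiset.mem_filter] at hw
    rcases h with h | h
    · exact hw.2 h.symm
    · have him : ζ.im = -w.im := by rw [h, Complex.conj_im]
      have := hM w hw.1
      apply hw.2
      rw [h]
      apply Complex.ext
      · simp
      · rw [Complex.conj_im]; linarith

/-- The order of vanishing of `conjPoly ζ ^ n * R` at `ζ` is `n`, when measured by powers of
`conjPoly ζ`. -/
theorem le_of_conjPoly_pow_mul_eq {ζ : ℂ} {s n : ℕ} {R : ℝ[X]} (hR : aeval ζ R ≠ 0) {h : ℂ → ℂ}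
    (hh : Continuous h)
    (he : ∀ z, aeval z (conjPoly ζ ^ s) * h z = aeval z (conjPoly ζ ^ n * R)) : s ≤ n := by
  by_contra! hlt
  obtain ⟨k, rfl⟩ := Nat.exists_eq_add_of_lt hlt
  have hd : Dense ({ζ, conj ζ}ᶜ : Set ℂ) := (Set.toFinite _).countable.dense_compl ℝ
  -- Cancel the n-th power off its two roots and extend by continuity; at ζ this gives R(ζ) = 0.
  have key : (fun z : ℂ => aeval z (conjPoly ζ ^ (k + 1)) * h z) = fun z => aeval z R := by
    refine Continuous.ext_on hd ((Polynomial.continuous_aeval _).mul hh)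
      (Polynomial.continuous_aeval _) fun z hz => ?_
    have hz0 : aeval z (conjPoly ζ ^ n) ≠ 0 := by
      rw [map_pow]
      exact pow_ne_zero _ fun h => hz (eq_or_eq_conj_of_aeval_conjPoly h)
    apply mul_left_cancel₀ hz0
    rw [← map_mul, ← he z, ← mul_assoc, ← map_mul, ← pow_add, add_assoc]
  apply hR
  rw [← congrFun key ζ]
  simp [aeval_conjPoly]

end RealPolynomials

/-! ### The squared norm on admissible pairs, and zeros on a sphere -/

section Admissible

variable {A : Type*} [NonAssocRing A] [IsAlternative A] [Module ℝ A]
    [IsScalarTower ℝ A A] [SMulCommClass ℝ A A] [StarRing A] [StarModule ℝ A]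

/-- Polarization of n at x, y and x + y. -/
theorem sqNorm_add_eq {x y : A} (h : (Submodule.span ℝ {x, y} : Set A) ⊆ normalCone A) :
    ∃ n₁ n₂ c : ℝ, x * star x = n₁ • (1 : A) ∧ y * star y = n₂ • (1 : A) ∧
      x * star y + y * star x = c • (1 : A) := by
  have hx : x ∈ Submodule.span ℝ {x, y} := Submodule.subset_span (by simp)
  have hy : y ∈ Submodule.span ℝ {x, y} := Submodule.subset_span (by simp)
  obtain ⟨n₁, h1, -⟩ := exists_sqNorm_of_mem_normalCone (h hx)
  obtain ⟨n₂, h2, -⟩ := exists_sqNorm_of_mem_normalCone (h hy)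
  obtain ⟨n₃, h3, -⟩ := exists_sqNorm_of_mem_normalCone (h (add_mem hx hy))
  refine ⟨n₁, n₂, n₃ - n₁ - n₂, h1, h2, ?_⟩
  rw [sub_smul, sub_smul, ← h1, ← h2, ← h3, star_add, add_mul, mul_add, mul_add]
  abel

/-- An anisotropic real quadratic form is definite. If n(x) = -n(y) ≠ 0, the quadratic s ↦ n(sx + y)
has nonnegative discriminant, and a real root gives y = -sx, so n(y) = s² n(x) has the sign of n(x)
or is zero. -/
theorem eq_zero_of_sqNorm_add_sqNorm [Nontrivial A] {x y : A}
    (h : (Submodule.span ℝ {x, y} : Set A) ⊆ normalCone A)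
    (h0 : x * star x + y * star y = 0) : x = 0 ∧ y = 0 := by
  have inj : Function.Injective fun r : ℝ => r • (1 : A) := smul_left_injective ℝ one_ne_zero
  have hx : x ∈ Submodule.span ℝ {x, y} := Submodule.subset_span (by simp)
  have hy : y ∈ Submodule.span ℝ {x, y} := Submodule.subset_span (by simp)
  have aniso : ∀ w ∈ Submodule.span ℝ {x, y}, w * star w = 0 → w = 0 := by
    intro w hw hw0
    obtain ⟨r, h1, h2, -⟩ := exists_sqNorm_of_mem_normalCone (h hw)
    exact h2 (inj (by simp only; rw [← h1, hw0, zero_smul]))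
  obtain ⟨n₁, n₂, c, h1, h2, h3⟩ := sqNorm_add_eq h
  have hn : n₁ + n₂ = 0 := inj (by simp only; rw [add_smul, ← h1, ← h2, h0, zero_smul])
  have hn1 : n₁ = 0 := by
    by_contra hne
    obtain ⟨s, hs⟩ := exists_quadratic_eq_zero (a := n₁) (b := c) (c := n₂) hne
      ⟨√(discrim n₁ c n₂), (Real.mul_self_sqrt (by
        rw [discrim, show n₂ = -n₁ by linarith]; nlinarith [sq_nonneg c, sq_nonneg n₁])).symm⟩
    have hw : s • x + y = 0 := by
      refine aniso _ (add_mem (Submodule.smul_mem _ _ hx) hy) ?_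
      rw [star_add, star_smul, star_trivial]
      simp only [add_mul, mul_add, smul_mul_assoc, mul_smul_comm]
      calc _ = s • s • (x * star x) + s • (x * star y + y * star x) + y * star y := by module
        _ = (n₁ * (s * s) + c * s + n₂) • (1 : A) := by rw [h1, h2, h3]; module
        _ = 0 := by rw [hs, zero_smul]
    have hy' : y = (-s) • x := by rw [neg_smul]; exact eq_neg_of_add_eq_zero_right hw
    have : n₂ = s * s * n₁ := inj (by
      simp only
      rw [← h2, hy', star_smul, star_trivial, smul_mul_assoc, mul_smul_comm, h1]
      module)
    have h5 : n₁ * (1 + s * s) = 0 := by linarith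
    rcases mul_eq_zero.1 h5 with h | h
    · exact hne h
    · nlinarith [mul_self_nonneg s]
  have hn2 : n₂ = 0 := by linarith
  exact ⟨aniso x hx (by rw [h1, hn1, zero_smul]), aniso y hy (by rw [h2, hn2, zero_smul])⟩

/-- A zero of an admissible slice function is a zero of its normal function. -/
theorem normal_eq_zero_of_zero [Nontrivial A] {x y J : A}
    (h : (Submodule.span ℝ {x, y} : Set A) ⊆ normalCone A) (hJ : J ∈ imagUnits A)
    (h0 : x + J * y = 0) :
    x * star x - y * star y = 0 ∧ x * star y + y * star x = 0 := by
  obtain ⟨n₁, hx, -, hx', -⟩ :=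
    exists_sqNorm_of_mem_normalCone (h (Submodule.subset_span (by simp : x ∈ {x, y})))
  obtain ⟨n₂, hy, -, hy', -⟩ :=
    exists_sqNorm_of_mem_normalCone (h (Submodule.subset_span (by simp : y ∈ {x, y})))
  have hJy : J * y = -x := eq_neg_of_add_eq_zero_right h0
  have hJx : J * x = y := by
    have := IsAlternative.assoc_left J y
    rw [associator_apply, hJ.2, hJy, mul_neg, sub_neg_eq_add, neg_one_mul] at this
    exact (neg_add_eq_zero.1 this).symm
  have e1 : y * star x = n₁ • J := by rw [← hJx, hx']
  have e2 : x * star y = -(n₂ • J) := by rw [← hy', hJy, neg_mul, neg_neg]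
  -- Conjugating `e1` computes the same product as `e2`; comparison yields n₁ = n₂.
  have e3 : x * star y = -(n₁ • J) := by
    have := congrArg star e1
    rwa [star_mul, star_star, star_smul, star_of_mem_imagUnits hJ, star_trivial n₁, smul_neg] at this
  have hJ0 : J ≠ 0 := by simpa using real_ne_imag hJ.2 0
  have hn : n₁ = n₂ := smul_left_injective ℝ hJ0 (neg_injective (e3.symm.trans e2))
  exact ⟨by rw [hx, hy, hn, sub_self], by rw [e1, e3, neg_add_cancel]⟩

/-- On the sphere of a zero of its normal function, an admissible slice function has a zero. -/
theorem exists_zero_of_normal_eq_zero {x y : A} (hS : ∃ J, J ∈ imagUnits A)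
    (h : (Submodule.span ℝ {x, y} : Set A) ⊆ normalCone A)
    (h1 : x * star x - y * star y = 0) (h2 : x * star y + y * star x = 0) :
    ∃ J ∈ imagUnits A, x + J * y = 0 := by
  obtain ⟨n₁, hx, hx0, -, hx'⟩ :=
    exists_sqNorm_of_mem_normalCone (h (Submodule.subset_span (by simp : x ∈ {x, y})))
  obtain ⟨n₂, hy, hy0, hyr, hy'⟩ :=
    exists_sqNorm_of_mem_normalCone (h (Submodule.subset_span (by simp : y ∈ {x, y})))
  by_cases hn : n₂ = 0
  · obtain ⟨J, hJ⟩ := hS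
    have hy1 := hy0 hn
    have hx1 : x = 0 := by
      by_contra hxne
      have hn1 : n₁ ≠ 0 := fun h => hxne (hx0 h)
      rw [hy1, zero_mul, sub_zero] at h1
      have := hx' x
      have h3 : (1 : A) = 0 := by
        rw [hx] at h1
        exact (smul_eq_zero.1 h1).resolve_left hn1
      exact hxne (by rw [← mul_one x, h3, mul_zero])
    exact ⟨J, hJ, by rw [hx1, hy1, mul_zero, add_zero]⟩
  -- The only candidate is J = -xy⁻¹ with y⁻¹ = n₂⁻¹ y^c. The hypothesis `h2` makes J^c = -J, and
  -- `h1` leads to J²y = -y, whence J² = -1 after right multiplication by y^c.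
  obtain ⟨J, hJdef⟩ : ∃ J : A, J = -(n₂⁻¹ • (x * star y)) := ⟨_, rfl⟩
  have hJ' : J = n₂⁻¹ • (y * star x) := by
    rw [hJdef, eq_neg_of_add_eq_zero_left h2, smul_neg, neg_neg]
  have hJy : J * y = -x := by
    rw [hJdef, neg_mul, smul_mul_assoc, hy', inv_smul_smul₀ hn]
  have hn12 : n₁ • y = n₂ • y := by
    have : n₁ • (1 : A) = n₂ • (1 : A) := by rw [← hx, ← hy]; exact sub_eq_zero.1 h1
    rw [← one_mul y, ← smul_mul_assoc, this, smul_mul_assoc]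
  have hJx : J * x = y := by
    rw [hJ', smul_mul_assoc, hx', hn12, inv_smul_smul₀ hn]
  refine ⟨J, mem_imagUnits_of_star ?_ ?_, by rw [hJy, add_neg_cancel]⟩
  · rw [hJ', star_smul, star_mul, star_star, star_trivial, ← hJ', hJdef, neg_neg]
  · have h3 : J * J * y = -y := by
      have := IsAlternative.assoc_left J y
      rw [associator_apply, hJy, mul_neg, sub_neg_eq_add, hJx] at this
      exact eq_neg_of_add_eq_zero_left this
    have h4 := hyr (J * J)
    rw [h3, neg_mul, hy] at h4
    apply smul_right_injective A hn
    simp only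
    rw [← h4, smul_neg]

end Admissible

/-! ### Slice functions with real coefficients and their divisibility -/

section RealStem

open Polynomial

theorem aeval_complex_ofReal (p : ℝ[X]) (r : ℝ) :
    aeval (r : ℂ) p = ((p.eval r : ℝ) : ℂ) :=
  aeval_ofReal (K := ℂ) p r

variable {A : Type*} [NonAssocRing A] [Module ℝ A]

/-- The stem function `z ↦ R(z)` of a polynomial `R` with real coefficients. -/
noncomputable def realStem (R : ℝ[X]) : StemFunction A where
  fst z := (aeval z R).re • 1
  snd z := (aeval z R).im • 1
  fst_conj z := by rw [aeval_conj, Complex.conj_re]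
  snd_conj z := by rw [aeval_conj, Complex.conj_im, neg_smul]

theorem isHolomorphic_realStem (R : ℝ[X]) : (realStem R : StemFunction A).IsHolomorphic := by
  intro φ
  have : (fun z : ℂ => (⟨φ ((realStem R : StemFunction A).fst z),
      φ ((realStem R : StemFunction A).snd z)⟩ : ℂ)) = fun z => aeval z R * (φ 1 : ℂ) := by
    funext z
    apply Complex.ext <;> simp [realStem]
  rw [this]
  exact R.differentiable_aeval.mul_const _

variable [IsScalarTower ℝ A A] [SMulCommClass ℝ A A]

theorem realStem_mul (R S : ℝ[X]) :
    (realStem R : StemFunction A).mul (realStem S) = realStem (R * S) := by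
  ext z
  · simp only [StemFunction.mul, realStem, map_mul, Complex.mul_re, smul_mul_assoc, one_mul]
    module
  · simp only [StemFunction.mul, realStem, map_mul, Complex.mul_im, smul_mul_assoc, one_mul]
    module

theorem realStem_npow (R : ℝ[X]) (s : ℕ) :
    (realStem R : StemFunction A).npow s = realStem (R ^ s) := by
  induction s with
  | zero => ext z <;> simp [StemFunction.npow, StemFunction.one, realStem]
  | succ s ih => rw [StemFunction.npow, ih, realStem_mul, pow_succ']

variable [StarRing A] [StarModule ℝ A]

/-- Δ_y depends only on the sphere of y, so multiplicities can be computed in ℝ[X]. -/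
theorem charStem_eq_realStem [Nontrivial A] {α β : ℝ} {J : A} (hJ : J ∈ imagUnits A) {ζ : ℂ}
    (hre : ζ.re = α) (him : ζ.im ^ 2 = β ^ 2) :
    charStem (α • (1 : A) + β • J) = realStem (conjPoly ζ) := by
  have hstar : star (α • (1 : A) + β • J) = α • (1 : A) - β • J := by
    rw [star_add, star_real, star_smul, star_of_mem_imagUnits hJ, star_trivial, smul_neg,
      sub_eq_add_neg]
  ext z
  · simp only [charStem, StemFunction.normal, StemFunction.mul, StemFunction.cconj, linStem,
      realStem, star_sub, star_real, hstar, aeval_conjPoly]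
    simp only [add_mul, sub_mul, mul_sub, smul_mul_assoc, mul_smul_comm, one_mul, mul_one, hJ.2,
      Complex.mul_re, Complex.sub_re, Complex.conj_re, Complex.conj_im, hre]
    linear_combination (norm := module) -him • (1 : A)
  · simp only [charStem, StemFunction.normal, StemFunction.mul, StemFunction.cconj, linStem,
      realStem, star_sub, star_real, hstar, aeval_conjPoly]
    simp only [sub_mul, mul_sub, smul_mul_assoc, mul_smul_comm, one_mul, mul_one,
      Complex.mul_im, Complex.sub_im, Complex.conj_re, Complex.conj_im, hre]
    module

variable [IsAlternative A]

/-- A slice function determines its stem function. -/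
theorem eq_of_eqOn_slice [Nontrivial A] (hS : ∃ J : A, J ∈ imagUnits A) {F G : StemFunction A}
    (h : Set.EqOn F.slice G.slice (quadraticCone A)) : F = G := by
  obtain ⟨J, hJ⟩ := hS
  have key : ∀ z, F.fst z - G.fst z = 0 ∧ F.snd z - G.snd z = 0 := by
    intro z
    have h1 := h (add_smul_mem_quadraticCone z.re z.im hJ)
    have h2 := h (add_smul_mem_quadraticCone z.re z.im (neg_mem_imagUnits hJ))
    rw [StemFunction.slice_apply _ _ _ hJ, StemFunction.slice_apply _ _ _ hJ] at h1
    rw [StemFunction.slice_apply _ _ _ (neg_mem_imagUnits hJ),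
      StemFunction.slice_apply _ _ _ (neg_mem_imagUnits hJ)] at h2
    simp only [Complex.eta, neg_mul] at h1 h2
    have h3 : (2 : ℝ) • (F.fst z - G.fst z) = 0 := by
      linear_combination (norm := module) h1 + h2
    have h4 : F.fst z - G.fst z = 0 := (smul_eq_zero.1 h3).resolve_left two_ne_zero
    have h5 : J * (F.snd z - G.snd z) = 0 := by
      rw [mul_sub]
      linear_combination (norm := module) h1 - h4
    have h6 := IsAlternative.assoc_left J (F.snd z - G.snd z)
    rw [associator_apply, h5, mul_zero, sub_zero, hJ.2, neg_one_mul, neg_eq_zero] at h6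
    exact ⟨h4, h6⟩
  ext z
  · exact sub_eq_zero.1 (key z).1
  · exact sub_eq_zero.1 (key z).2

theorem sliceDvd_realStem_iff [Nontrivial A] [Module.Finite ℝ A]
    (hS : ∃ J : A, J ∈ imagUnits A) {ζ : ℂ}
    {n : ℕ} {R : ℝ[X]} (hR : aeval ζ R ≠ 0) (s : ℕ) :
    SliceDvd (realStem (conjPoly ζ ^ s) : StemFunction A) (realStem (conjPoly ζ ^ n * R)) ↔
      s ≤ n := by
  constructor
  · rintro ⟨H, hH, he⟩
    -- A functional not vanishing at 1 turns the A-valued factorization into one of complex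
    -- functions, with R scaled by φ(1) and an entire quotient.
    obtain ⟨φ, hφ⟩ := Module.Projective.exists_dual_ne_zero ℝ (one_ne_zero (α := A))
    have he' := eq_of_eqOn_slice hS he
    have hR' : aeval ζ (C (φ 1) * R) ≠ 0 := by simpa [hφ] using hR
    refine le_of_conjPoly_pow_mul_eq hR' (hH φ).continuous fun z => ?_
    have h1 := congrArg (fun G : StemFunction A => φ (G.fst z)) he'
    have h2 := congrArg (fun G : StemFunction A => φ (G.snd z)) he'
    simp only [StemFunction.mul, realStem, smul_mul_assoc, one_mul, map_smul, map_add, map_sub,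
      smul_eq_mul] at h1 h2
    rw [mul_left_comm, map_mul (aeval z) (C _), aeval_C]
    apply Complex.ext
    · rw [Complex.mul_re, ← h1]; simp [mul_comm]
    · rw [Complex.mul_im, ← h2]; simp [mul_comm]
  · intro h
    obtain ⟨k, rfl⟩ := Nat.exists_eq_add_of_le h
    refine ⟨realStem (conjPoly ζ ^ k * R), isHolomorphic_realStem _, fun x _ => ?_⟩
    rw [realStem_mul, ← mul_assoc, ← pow_add]

end RealStem

/-! ### The normal function as a real polynomial -/

section Normal

open Polynomial

variable {A : Type*} [NonAssocRing A] [Module ℝ A]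
  [IsScalarTower ℝ A A] [SMulCommClass ℝ A A] [StarRing A] [StarModule ℝ A]

/-- The image of the normal function of `∑ x ^ j a_j` under a functional on the coefficients. -/
noncomputable def normalPoly {m : ℕ} (φ : A →ₗ[ℝ] ℝ) (a : Fin (m + 1) → A) : ℝ[X] :=
  ∑ j : Fin (m + 1), ∑ k : Fin (m + 1), monomial ((j : ℕ) + k) (φ (a j * star (a k)))

theorem map_normal_fst {m : ℕ} (φ : A →ₗ[ℝ] ℝ) (a : Fin (m + 1) → A) (z : ℂ) :
    φ ((polyStem a).normal.fst z) = (aeval z (normalPoly φ a)).re := by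
  simp only [StemFunction.normal, StemFunction.mul, StemFunction.cconj, polyStem, normalPoly,
    star_sum, star_smul, star_trivial, Finset.sum_mul_sum, smul_mul_assoc, mul_smul_comm,
    ← Finset.sum_sub_distrib, map_sum, map_sub, map_smul, aeval_monomial, Complex.re_sum,
    pow_add, Complex.mul_re, Complex.mul_im, smul_eq_mul, Complex.coe_algebraMap,
    Complex.ofReal_re, Complex.ofReal_im]
  refine Finset.sum_congr rfl fun j _ => Finset.sum_congr rfl fun k _ => ?_
  ring

theorem map_normal_snd {m : ℕ} (φ : A →ₗ[ℝ] ℝ) (a : Fin (m + 1) → A) (z : ℂ) :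
    φ ((polyStem a).normal.snd z) = (aeval z (normalPoly φ a)).im := by
  simp only [StemFunction.normal, StemFunction.mul, StemFunction.cconj, polyStem, normalPoly,
    star_sum, star_smul, star_trivial, Finset.sum_mul_sum, smul_mul_assoc, mul_smul_comm,
    ← Finset.sum_add_distrib, map_sum, map_add, map_smul, aeval_monomial, Complex.im_sum,
    pow_add, Complex.mul_re, Complex.mul_im, smul_eq_mul, Complex.coe_algebraMap,
    Complex.ofReal_re, Complex.ofReal_im]
  refine Finset.sum_congr rfl fun j _ => Finset.sum_congr rfl fun k _ => ?_
  ring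

theorem natDegree_normalPoly_le {m : ℕ} (φ : A →ₗ[ℝ] ℝ) (a : Fin (m + 1) → A) :
    (normalPoly φ a).natDegree ≤ 2 * m :=
  natDegree_sum_le_of_forall_le _ _ fun j _ => natDegree_sum_le_of_forall_le _ _ fun k _ =>
    (natDegree_monomial_le _).trans (by omega)

theorem coeff_normalPoly {m : ℕ} (φ : A →ₗ[ℝ] ℝ) (a : Fin (m + 1) → A) :
    (normalPoly φ a).coeff (2 * m) = φ (sqNorm (a (Fin.last m))) := by
  simp only [normalPoly, finsetSum_coeff, coeff_monomial]
  rw [Finset.sum_eq_single (Fin.last m), Finset.sum_eq_single (Fin.last m)]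
  · simp [sqNorm, two_mul]
  · intro k _ hk
    rw [if_neg]
    intro h
    exact hk (Fin.ext (by simp at h ⊢; omega))
  · simp
  · intro j _ hj
    refine Finset.sum_eq_zero fun k _ => ?_
    rw [if_neg]
    intro h
    exact hj (Fin.ext (by simp at h ⊢; omega))
  · simp

theorem isAdmissible_polyStem_of_span_subset {m : ℕ} {a : Fin (m + 1) → A}
    (h : (Submodule.span ℝ (Set.range a) : Set A) ⊆ normalCone A) :
    (polyStem a).IsAdmissible := by
  intro z
  refine subset_trans (SetLike.coe_subset_coe.2 (Submodule.span_le.2 ?_)) h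
  have (c : Fin (m + 1) → ℝ) : ∑ j, c j • a j ∈ Submodule.span ℝ (Set.range a) :=
    sum_mem fun j _ => Submodule.smul_mem _ _ (Submodule.subset_span ⟨j, rfl⟩)
  rintro _ (rfl | rfl)
  · exact this _
  · exact this _

theorem exists_polyStem_fst_ne_zero [Module.Finite ℝ A] {m : ℕ} {a : Fin (m + 1) → A}
    (ha : a (Fin.last m) ≠ 0) : ∃ r : ℝ, (polyStem a).fst r ≠ 0 := by
  obtain ⟨ψ, hψ⟩ := Module.Projective.exists_dual_ne_zero ℝ ha
  by_contra! h
  have h0 : ∑ j : Fin (m + 1), monomial (j : ℕ) (ψ (a j)) = (0 : ℝ[X]) := by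
    refine Polynomial.funext fun r => ?_
    have := congrArg ψ (h r)
    simpa [polyStem, ← Complex.ofReal_pow, eval_finsetSum, eval_monomial, mul_comm] using this
  have := congrArg (fun p => coeff p m) h0
  simp only [finsetSum_coeff, coeff_monomial, coeff_zero] at this
  rw [Finset.sum_eq_single (Fin.last m)] at this
  · exact hψ (by simpa using this)
  · intro k _ hk
    rw [if_neg]
    intro h
    exact hk (Fin.ext (by simpa using h))
  · simp

theorem normal_fst_ofReal {m : ℕ} (a : Fin (m + 1) → A) (r : ℝ) :
    (polyStem a).normal.fst r = (polyStem a).fst r * star ((polyStem a).fst r) ∧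
      (polyStem a).snd r = 0 := by
  have : (polyStem a).snd r = 0 := by simp [polyStem, ← Complex.ofReal_pow]
  refine ⟨?_, this⟩
  simp [StemFunction.normal, StemFunction.mul, StemFunction.cconj, this]

variable [IsAlternative A]

/-- By admissibility both components of the normal function are real multiples of 1, so a functional
with φ(1) = 1 loses no information. -/
theorem normal_eq_realStem {m : ℕ} {a : Fin (m + 1) → A} (h : (polyStem a).IsAdmissible)
    {φ : A →ₗ[ℝ] ℝ} (hφ : φ 1 = 1) : (polyStem a).normal = realStem (normalPoly φ a) := by
  ext z
  · obtain ⟨n₁, n₂, c, h1, h2, h3⟩ := sqNorm_add_eq (h z)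
    have h4 : (polyStem a).normal.fst z = (n₁ - n₂) • (1 : A) := by
      rw [sub_smul, ← h1, ← h2]; rfl
    have h5 := map_normal_fst φ a z
    rw [h4, map_smul, hφ, smul_eq_mul, mul_one] at h5
    rw [h4, h5]; rfl
  · obtain ⟨n₁, n₂, c, h1, h2, h3⟩ := sqNorm_add_eq (h z)
    have h4 : (polyStem a).normal.snd z = c • (1 : A) := h3
    have h5 := map_normal_snd φ a z
    rw [h4, map_smul, hφ, smul_eq_mul, mul_one] at h5
    rw [h4, h5]; rfl

/-- The leading coefficient of the normal function of an admissible polynomial is real. -/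
theorem map_sqNorm_last_ne_zero [Module.Finite ℝ A] {m : ℕ} {a : Fin (m + 1) → A}
    (h : (polyStem a).IsAdmissible) {φ : A →ₗ[ℝ] ℝ} (hφ : φ 1 = 1)
    (hn : sqNorm (a (Fin.last m)) ≠ 0) : φ (sqNorm (a (Fin.last m))) ≠ 0 := by
  intro h0
  apply hn
  rw [← Module.forall_dual_apply_eq_zero_iff ℝ]
  intro ψ
  -- Admissibility concerns values, not coefficients. Comparing the coefficients of degree 2m for
  -- every ψ shows that n(a_m) is determined by its image under φ.
  have hp : normalPoly ψ a = C (ψ 1) * normalPoly φ a := by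
    refine Polynomial.funext fun r => ?_
    have h1 := map_normal_fst ψ a r
    have he (p : ℝ[X]) : (aeval (r : ℂ) p).re = p.eval r := by
      rw [aeval_complex_ofReal, Complex.ofReal_re]
    rw [normal_eq_realStem h hφ, he] at h1
    rw [← h1, eval_mul, eval_C, ← he]
    simp [realStem, mul_comm]
  have := congrArg (fun p => coeff p (2 * m)) hp
  simp only [coeff_C_mul, coeff_normalPoly, h0, mul_zero] at this
  exact this

theorem eval_normalPoly_ne_zero [Nontrivial A] {m : ℕ} {a : Fin (m + 1) → A}
    (h : (polyStem a).IsAdmissible) {φ : A →ₗ[ℝ] ℝ} (hφ : φ 1 = 1)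
    {r : ℝ} (hr : (polyStem a).fst r ≠ 0) : (normalPoly φ a).eval r ≠ 0 := by
  intro h0
  apply hr
  have h1 := congrArg (fun F : StemFunction A => F.fst r) (normal_eq_realStem h hφ)
  obtain ⟨h2, h3⟩ := normal_fst_ofReal a r
  simp only [h2, realStem] at h1
  rw [aeval_complex_ofReal, h0, Complex.ofReal_zero, Complex.zero_re, zero_smul] at h1
  exact (eq_zero_of_sqNorm_add_sqNorm (h r) (by rw [h1, h3, zero_mul, add_zero])).1

/-- The normal function of an admissible polynomial does not change sign on the real line. -/
theorem normalPoly_sign [Nontrivial A] {m : ℕ} {a : Fin (m + 1) → A}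
    (h : (polyStem a).IsAdmissible) {φ : A →ₗ[ℝ] ℝ} (hφ : φ 1 = 1)
    (hq : normalPoly φ a ≠ 0) :
    (∀ r, 0 ≤ (normalPoly φ a).eval r) ∨ ∀ r, (normalPoly φ a).eval r ≤ 0 := by
  by_contra! hcon
  obtain ⟨⟨r, hr⟩, s, hs⟩ := hcon
  -- On ℝ, where F₂ = 0, g agrees with N(p). By definiteness a zero of g is a common zero of F₁ and
  -- F₂, so g has finitely many zeros. A sign change on ℝ could be joined by a path in ℂ avoiding
  -- them.
  let g : ℂ → ℝ := fun z =>
    φ ((polyStem a).fst z * star ((polyStem a).fst z)) +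
      φ ((polyStem a).snd z * star ((polyStem a).snd z))
  have hg : Continuous g := by
    simp only [g, polyStem, star_sum, star_smul, star_trivial, Finset.sum_mul_sum,
      smul_mul_assoc, mul_smul_comm, map_sum, map_smul, smul_eq_mul]
    fun_prop
  have hgr (r : ℝ) : g r = (normalPoly φ a).eval r := by
    obtain ⟨h2, h3⟩ := normal_fst_ofReal a r
    have h1 := map_normal_fst φ a r
    rw [aeval_complex_ofReal, Complex.ofReal_re, h2] at h1
    simp only [g, h3, zero_mul, map_zero, add_zero, h1]
  have hg0 (z : ℂ) (hz : g z = 0) : aeval z (normalPoly φ a) = 0 := by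
    obtain ⟨n₁, n₂, c, h1, h2, h3⟩ := sqNorm_add_eq (h z)
    have : (polyStem a).fst z = 0 ∧ (polyStem a).snd z = 0 := by
      apply eq_zero_of_sqNorm_add_sqNorm (h z)
      simp only [g, h1, h2, map_smul, hφ, smul_eq_mul, mul_one] at hz
      rw [h1, h2, ← add_smul, hz, zero_smul]
    apply Complex.ext
    · rw [← map_normal_fst]
      simp [StemFunction.normal, StemFunction.mul, this]
    · rw [← map_normal_snd]
      simp [StemFunction.normal, StemFunction.mul, this]
  have hfin : {z : ℂ | aeval z (normalPoly φ a) = 0}.Finite := by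
    refine (normalPoly φ a).rootSet_finite ℂ |>.subset fun z hz => ?_
    exact (mem_rootSet.2 ⟨hq, hz⟩)
  have hconn := (hfin.countable.isConnected_compl_of_one_lt_rank (by simp)).isPreconnected
  have hmem (r : ℝ) (hr : (normalPoly φ a).eval r ≠ 0) :
      (r : ℂ) ∈ {z : ℂ | aeval z (normalPoly φ a) = 0}ᶜ := by
    intro h0
    apply hr
    rw [Set.mem_ofPred_eq, aeval_complex_ofReal] at h0
    exact Complex.ofReal_eq_zero.1 h0
  obtain ⟨z, hz, hz0⟩ := hconn.intermediate_value (hmem r hr.ne) (hmem s hs.ne') hg.continuousOn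
    (show (0 : ℝ) ∈ Set.Icc (g r) (g s) from by rw [hgr, hgr]; exact ⟨hr.le, hs.le⟩)
  exact hz (hg0 z hz0)

/-- The normal function of an admissible polynomial is a product of real quadratic polynomials. -/
theorem exists_normal_eq_realStem_prod [Nontrivial A] [Module.Finite ℝ A] {m : ℕ}
    {a : Fin (m + 1) → A} (ha : a (Fin.last m) ≠ 0) (h : (polyStem a).IsAdmissible) :
    ∃ c : ℝ, c ≠ 0 ∧ ∃ M : Multiset ℂ, (∀ ζ ∈ M, 0 ≤ ζ.im) ∧
      (polyStem a).normal = realStem (C c * (M.map conjPoly).prod) ∧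
      (sqNorm (a (Fin.last m)) ≠ 0 → M.card = m) := by
  obtain ⟨φ, hφ⟩ : ∃ φ : A →ₗ[ℝ] ℝ, φ 1 = 1 := by
    obtain ⟨φ, hφ⟩ := Module.Projective.exists_dual_ne_zero ℝ (one_ne_zero (α := A))
    exact ⟨(φ 1)⁻¹ • φ, by simp [hφ]⟩
  obtain ⟨r, hr⟩ := exists_polyStem_fst_ne_zero ha
  have hq : normalPoly φ a ≠ 0 := by
    intro h0
    exact eval_normalPoly_ne_zero h hφ hr (by rw [h0, eval_zero])
  have hfac : ∃ c : ℝ, c ≠ 0 ∧ ∃ M : Multiset ℂ, (∀ ζ ∈ M, 0 ≤ ζ.im) ∧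
      normalPoly φ a = C c * (M.map conjPoly).prod := by
    rcases normalPoly_sign h hφ hq with hs | hs
    · exact exists_eq_prod_conjPoly _ hq hs
    · obtain ⟨c, hc, M, hM, he⟩ := exists_eq_prod_conjPoly (-normalPoly φ a) (neg_ne_zero.2 hq)
        (fun r => by rw [eval_neg]; exact neg_nonneg.2 (hs r))
      exact ⟨-c, neg_ne_zero.2 hc, M, hM, by rw [C_neg, neg_mul, ← he, neg_neg]⟩
  obtain ⟨c, hc, M, hM, he⟩ := hfac
  refine ⟨c, hc, M, hM, by rw [← he, normal_eq_realStem h hφ], fun hn => ?_⟩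
  have h1 : (normalPoly φ a).natDegree = 2 * m :=
    le_antisymm (natDegree_normalPoly_le φ a)
      (le_natDegree_of_ne_zero (by rw [coeff_normalPoly]; exact map_sqNorm_last_ne_zero h hφ hn))
  rw [he, natDegree_prod_conjPoly hc] at h1
  omega

end Normal

/-! ### Spheres and zeros of real slice functions -/

section Zeros

open Polynomial

variable {A : Type*} [NonAssocRing A] [Nontrivial A] [Module ℝ A]
  [IsScalarTower ℝ A A] [SMulCommClass ℝ A A] [StarRing A] [StarModule ℝ A]

theorem mem_sphere_iff {α β : ℝ} {J : A} (hJ : J ∈ imagUnits A) {y : A} :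
    y ∈ sphere (α • (1 : A) + β • J) ↔ ∃ I ∈ imagUnits A, y = α • (1 : A) + β • I := by
  constructor
  · rintro ⟨α', β', J', hJ', I, hI, h1, rfl⟩
    obtain ⟨rfl, hβ⟩ := add_smul_inj hJ hJ' h1
    rcases sq_eq_sq_iff_eq_or_eq_neg.1 hβ with rfl | rfl
    · exact ⟨I, hI, rfl⟩
    · exact ⟨-I, neg_mem_imagUnits hI, by simp⟩
  · rintro ⟨I, hI, rfl⟩
    exact ⟨α, β, J, hJ, I, hI, rfl, rfl⟩

theorem realStem_slice_eq_zero_iff {R : ℝ[X]} {α β : ℝ} {J : A} (hJ : J ∈ imagUnits A) :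
    (realStem R : StemFunction A).slice (α • (1 : A) + β • J) = 0 ↔ aeval (⟨α, β⟩ : ℂ) R = 0 := by
  rw [StemFunction.slice_apply _ _ _ hJ]
  simp only [realStem, mul_smul_comm, mul_one]
  constructor
  · intro h
    obtain ⟨h1, h2⟩ := add_smul_inj (α' := 0) (β' := 0) hJ hJ (by simpa using h)
    exact Complex.ext h1 (by simpa using h2)
  · intro h
    simp [h]

end Zeros

end SliceAlgebra

/-! ### The fundamental theorem -/

open SliceAlgebra
theorem mainTheorem1 {A : Type*} [NonAssocRing A] [IsAlternative A] [Module ℝ A]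
    [IsScalarTower ℝ A A] [SMulCommClass ℝ A A] [Module.Finite ℝ A]
    [StarRing A] [StarModule ℝ A] (hQ : quadraticCone A ≠ realLine A)
    (m : ℕ) (hm : 0 < m) (a : Fin (m + 1) → A) (ha : a (Fin.last m) ≠ 0) :
    ((Submodule.span ℝ (Set.range a) : Set A) ⊆ normalCone A →
      (polyStem a).IsAdmissible ∧ sqNorm (a (Fin.last m)) ≠ 0) ∧
    ((polyStem a).IsAdmissible →
      ∃ (t : ℕ) (x : Fin t → A),
        (∀ k, x k ∈ quadraticCone A) ∧
        Function.Injective (fun k => sphere (x k)) ∧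
        (zeroSet (polyEval a) ⊆ ⋃ k, sphere (x k)) ∧
        (⋃ k, sphere (x k)) = zeroSet (polyStem a).normal.slice ∧
        (∀ k, (zeroSet (polyEval a) ∩ sphere (x k)).Nonempty) ∧
        (sqNorm (a (Fin.last m)) ≠ 0 →
          (zeroSet (polyEval a)).Nonempty ∧
          ∀ y : Fin t → A, (∀ k, y k ∈ sphere (x k) ∧ y k ∈ zeroSet (polyEval a)) →
            ∃ μ : Fin t → ℕ,
              (∀ k s, HasMultiplicity (polyStem a) (y k) s ↔ s = μ k) ∧
              ∑ k, μ k = m)) := by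
  have : Nontrivial A := ⟨_, _, ha⟩
  refine ⟨fun h => ⟨isAdmissible_polyStem_of_span_subset h, fun h0 => ?_⟩, fun hadm => ?_⟩
  · obtain ⟨r, h1, h2, -⟩ :=
      exists_sqNorm_of_mem_normalCone (h (Submodule.subset_span ⟨Fin.last m, rfl⟩))
    refine ha (h2 ?_)
    rw [sqNorm, h1] at h0
    exact (smul_eq_zero.1 h0).resolve_right one_ne_zero
  have hS := exists_imagUnit hQ
  obtain ⟨J, hJ⟩ := hS
  obtain ⟨c, hc, M, hM, hN, hcard⟩ := exists_normal_eq_realStem_prod ha hadm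
  -- Each distinct root in the closed upper half-plane contributes one sphere; real roots give
  -- one-point spheres.
  let e := M.toFinset.equivFin.symm
  have heM (k) : (e k : ℂ) ∈ M := Multiset.mem_toFinset.1 (e k).2
  let x : Fin M.toFinset.card → A := fun k => (e k : ℂ).re • (1 : A) + (e k : ℂ).im • J
  have hxQ (k) : x k ∈ quadraticCone A := add_smul_mem_quadraticCone _ _ hJ
  have hunion : (⋃ k, sphere (x k)) = zeroSet (polyStem a).normal.slice := by
    ext y
    rw [Set.mem_iUnion, hN]
    constructor
    · rintro ⟨k, hk⟩
      obtain ⟨I, hI, rfl⟩ := (mem_sphere_iff hJ).1 hk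
      refine ⟨add_smul_mem_quadraticCone _ _ hI, ?_⟩
      rw [realStem_slice_eq_zero_iff hI, aeval_prod_conjPoly_eq_zero hc]
      exact ⟨e k, heM k, Or.inl rfl⟩
    · rintro ⟨hy, h0⟩
      obtain ⟨α, β, I, hI, rfl⟩ := exists_eq_add_smul hQ hy
      rw [realStem_slice_eq_zero_iff hI, aeval_prod_conjPoly_eq_zero hc] at h0
      obtain ⟨ζ, hζ, h⟩ := h0
      refine ⟨e.symm ⟨ζ, Multiset.mem_toFinset.2 hζ⟩, (mem_sphere_iff hJ).2 ?_⟩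
      rw [Equiv.apply_symm_apply]
      rcases h with rfl | h
      · exact ⟨I, hI, rfl⟩
      · obtain ⟨h1, h2⟩ := Complex.ext_iff.1 h
        simp only [Complex.conj_re, Complex.conj_im] at h1 h2
        exact ⟨-I, neg_mem_imagUnits hI, by rw [h1, h2]; simp⟩
  have hzero (k) : (zeroSet (polyEval a) ∩ sphere (x k)).Nonempty := by
    have h0 : (polyStem a).normal.slice (x k) = 0 :=
      (hunion.subset (Set.mem_iUnion.2 ⟨k, ⟨_, _, J, hJ, J, hJ, rfl, rfl⟩⟩)).2
    rw [hN, realStem_slice_eq_zero_iff hJ] at h0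
    have h1 := congrArg (fun F : StemFunction A => F.fst (e k)) hN
    have h2 := congrArg (fun F : StemFunction A => F.snd (e k)) hN
    simp only [realStem, h0, Complex.eta, Complex.zero_re, Complex.zero_im, zero_smul] at h1 h2 h0
    obtain ⟨I, hI, h3⟩ := exists_zero_of_normal_eq_zero ⟨J, hJ⟩ (hadm (e k)) h1 h2
    refine ⟨(e k : ℂ).re • (1 : A) + (e k : ℂ).im • I,
      ⟨add_smul_mem_quadraticCone _ _ hI, ?_⟩, (mem_sphere_iff hJ).2 ⟨I, hI, rfl⟩⟩
    rw [slice_polyStem a _ _ hI, StemFunction.slice_apply _ _ _ hI]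
    exact h3
  refine ⟨M.toFinset.card, x, hxQ, ?_, ?_, hunion, hzero, fun hn => ⟨?_, fun y hy => ?_⟩⟩
  · intro k l hkl
    have h1 : x k ∈ sphere (x l) := by
      rw [← show sphere (x k) = sphere (x l) from hkl]
      exact ⟨_, _, J, hJ, J, hJ, rfl, rfl⟩
    obtain ⟨I, hI, h⟩ := (mem_sphere_iff hJ).1 h1
    obtain ⟨h2, h3⟩ := add_smul_inj hJ hI h
    refine e.injective (Subtype.ext (Complex.ext h2 ?_))
    -- Equal spheres only give equal squares of the imaginary parts; nonnegativity removes the sign.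
    exact (sq_eq_sq₀ (hM _ (heM k)) (hM _ (heM l))).1 h3
  · rw [hunion]
    rintro y ⟨hy, h0⟩
    refine ⟨hy, ?_⟩
    obtain ⟨α, β, I, hI, rfl⟩ := exists_eq_add_smul hQ hy
    rw [slice_polyStem a _ _ hI, StemFunction.slice_apply _ _ _ hI] at h0
    obtain ⟨h1, h2⟩ := normal_eq_zero_of_zero (hadm _) hI h0
    rw [StemFunction.slice_apply _ _ _ hI]
    simp only [StemFunction.normal, StemFunction.mul, StemFunction.cconj, h1, h2, mul_zero,
      add_zero]
  · have hpos : 0 < M.toFinset.card := by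
      rw [Finset.card_pos, Multiset.toFinset_nonempty, ← Multiset.card_pos, hcard hn]
      exact hm
    exact (hzero ⟨0, hpos⟩).mono Set.inter_subset_left
  -- The multiplicity is the number of occurrences of the root in M, independent of the zero chosen
  -- on its sphere; the counts sum to the cardinality m of M.
  · refine ⟨fun k => M.count (e k : ℂ), fun k s => ?_, ?_⟩
    · obtain ⟨I, hI, h⟩ := (mem_sphere_iff hJ).1 (hy k).1
      obtain ⟨R, hR, hR0⟩ := exists_eq_conjPoly_pow_count_mul hc hM (hM _ (heM k))
      rw [HasMultiplicity, h, charStem_eq_realStem hI rfl rfl, realStem_npow, realStem_npow, hN,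
        hR, sliceDvd_realStem_iff ⟨J, hJ⟩ hR0, sliceDvd_realStem_iff ⟨J, hJ⟩ hR0]
      beta_reduce; omega
    · rw [Equiv.sum_comp e (fun ζ => M.count (ζ : ℂ)), Finset.sum_coe_sort M.toFinset M.count,
        Multiset.toFinset_sum_count_eq, hcard hn]
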